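/- Call a probability measure $\nu$ on $[-\pi,\pi]$ admissible if it is absolutely continuous with respect to Lebesgue measure with a density $p\in\bigcap_{1\le q<\infty}L^q([-\pi,\pi])$, and its Fourier coefficients are nonnegative: $\int_{-\pi}^{\pi}e^{-imt}\,d\nu(t)\ge 0$ for all $m\in\mathbb Z$. For a partition $\rho$ of $\{1,\dots,n\}$, $n\ge 1$, with $r$ blocks $B_1,\dots,B_r$, write $\rho(j)=k$ if $j\in B_k$, and $\rho(n+1)=\rho(1)$. For a probability measure $\nu$ on $[-\pi,\pi]$ and $N\ge r$ put $$K_{\rho,\nu,N}=\frac{1}{N^{n+1}}\cdot\frac{N!}{(N-r)!}\int_{[-\pi,\pi]^r}\prod_{j=1}^{n}F_N\big(x_{\rho(j)}-x_{\rho(j+1)}\big)\,d\nu(x_1)\cdots d\nu(x_r),\qquad F_N(x)=\frac{\sin(Nx/2)}{\sin(x/2)},$$ where $F_N$ is extended by continuity to $2\pi\mathbb Z$ (so $F_N(0)=N$). The Vandermonde expansion coefficient is $K_{\rho,\nu}=\lim_{N\to\infty}K_{\rho,\nu,N}$, when this (finite) limit exists. Let $u$ be the uniform law on $[-\pi,\pi]$.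 Theorem. If $\nu$ is admissible with density $p$, then for every $n\ge 1$ and every partition $\rho$ of $\{1,\dots,n\}$ with $r$ blocks, the coefficients $K_{\rho,\nu}$ and $K_{\rho,u}$ exist and $$K_{\rho,\nu}=K_{\rho,u}\cdot(2\pi)^{r-1}\int_{-\pi}^{\pi}p(x)^r\,dx .$$ Moreover, there is an admissible $\nu$ whose density is not essentially bounded. -/

import Mathlib

open MeasureTheory Filter Topology

namespace RandomVandermonde

noncomputable section

/-- The phase interval `[-π, π]` with Lebesgue measure, as a measure on `ℝ`. -/
def lebesgueOnPhases : Measure ℝ := volume.restrict (Set.Icc (-Real.pi) Real.pi)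

/-- The uniform probability law on `[-π, π]`. -/
def uniformLaw : Measure ℝ := ENNReal.ofReal (1 / (2 * Real.pi)) • lebesgueOnPhases

/-- The Fourier coefficient `φ(m) = ∫ e^{-imt} dν(t)`. -/
def fourierCoefficient (ν : Measure ℝ) (m : ℤ) : ℂ :=
  ∫ t : ℝ, Complex.exp (-Complex.I * (m : ℂ) * (t : ℂ)) ∂ν

/-- `ν` is a probability measure on `[-π, π]` with density `p` (with respect to Lebesgue measure),
`p` lies in `L^q([-π, π])` for all `1 ≤ q < ∞`, and all Fourier coefficients of `ν` are
nonnegative real numbers. The values of `p` outside `[-π, π]` play no role. -/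
structure HasAdmissibleDensity (ν : Measure ℝ) (p : ℝ → ℝ) : Prop where
  isProbabilityMeasure : IsProbabilityMeasure ν
  density_nonneg : ∀ᵐ x ∂lebesgueOnPhases, 0 ≤ p x
  eq_withDensity : ν = lebesgueOnPhases.withDensity (fun x => ENNReal.ofReal (p x))
  memLp : ∀ q : NNReal, 1 ≤ q → MemLp p (q : ENNReal) lebesgueOnPhases
  fourier_nonneg : ∀ m : ℤ,
    0 ≤ (fourierCoefficient ν m).re ∧ (fourierCoefficient ν m).im = 0

/-- The kernel `F(x) = sin(Nx/2) / sin(x/2)`, extended by continuity to the zeros of `sin(x/2)`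
(so that `F(0) = N`). -/
def kernelF (N : ℕ) (x : ℝ) : ℝ :=
  if Real.sin (x / 2) = 0 then N * Real.cos (N / 2 * x) / Real.cos (x / 2)
  else Real.sin (N / 2 * x) / Real.sin (x / 2)

variable {n : ℕ}

/-- The block of `ρ` containing `j`; this is the map `j ↦ ρ(j)`, with values in the set of blocks
rather than in a numbering of it. -/
def blockOf (ρ : Finpartition (Finset.univ : Finset (Fin n))) (j : Fin n) : ρ.parts :=
  ⟨ρ.part j, ρ.part_mem.mpr (Finset.mem_univ j)⟩

/-- `F_ρ(x) = ∏_j F(x_{ρ(j)} - x_{ρ(j+1)})`, with one variable for each block and the index `j`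
read cyclically (addition in `Fin n` is modulo `n`). -/
def kernelProduct [NeZero n] (ρ : Finpartition (Finset.univ : Finset (Fin n))) (N : ℕ)
    (x : ρ.parts → ℝ) : ℝ :=
  ∏ j : Fin n, kernelF N (x (blockOf ρ j) - x (blockOf ρ (j + 1)))

/-- `K_{ρ,ν,N} = N^{-(n+1)} * (N! / (N-r)!) * ∫ F_ρ(x_1, …, x_r) dν(x_1) ⋯ dν(x_r)`, where `r` is the
number of blocks of `ρ`. This is the contribution of the index tuples with pattern `ρ` to
`E[tr_N((V* V)^n)]` for the `N × N` random Vandermonde matrix `V` with i.i.d. phases of law `ν`. -/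
def finiteCoefficient [NeZero n] (ρ : Finpartition (Finset.univ : Finset (Fin n)))
    (ν : Measure ℝ) (N : ℕ) : ℝ :=
  1 / (N : ℝ) ^ (n + 1) * (N.descFactorial ρ.parts.card : ℝ) *
    ∫ x : ρ.parts → ℝ, kernelProduct ρ N x ∂(Measure.pi fun _ => ν)

/-- The Vandermonde expansion coefficient `K_{ρ,ν} = lim_N K_{ρ,ν,N}` exists and equals `K`. -/
def IsExpansionCoefficient [NeZero n] (ρ : Finpartition (Finset.univ : Finset (Fin n)))
    (ν : Measure ℝ) (K : ℝ) : Prop :=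
  Tendsto (fun N : ℕ => finiteCoefficient ρ ν N) atTop (𝓝 K)

end

end RandomVandermonde

/-! Each kernel is, up to a half-angle phase, the Dirichlet sum `∑_{k<N} e^{ikx}`, and these phases
cancel around the cycle. Expanding the product and integrating gives a sum over `k ∈ [0,N)^n` of
`∏_b φ(flux_b(k))`, where `φ` is the Fourier coefficient sequence of `ν` and `flux_b` the net flux
of the edge weights `k` into the block `b`.

The fluxes add up to zero, so `r - 1` of them determine the last one. The remaining ones form a
surjection `ℤ^n → ℤ^(r-1)`, because the walk visits every block. Its fibres contain `V N^d + o(N^d)`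
points of the cube, `d = n - r + 1`, with one constant `V` for all fibres and a bound `C N^d`
uniform in the fibre (`exists_tendsto_fiberCount`). As `φ ≥ 0`, dominated convergence reduces the
limit to `V` times `∑_m φ(-∑ m_i) ∏ φ(m_i)`, provided this series converges
(`exists_tendsto_box_average`).

The series is the `r`-fold convolution power of `φ` at `0`, equal to `(2π)^(r-1) ∫ p^r`
(`hasSum_density_coefficients`). Parseval applies at each stage since every power of `p` is in `L²`;
nonnegativity permits rearranging the sums. Since `V` depends only on `ρ`, and the uniform density
makes the other factor `1`, `V = K_{ρ,u}`.

The unbounded example is a normalized sum of Fejér kernels of order `2^k`, each with peak `1` at the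
origin. -/

namespace RandomVandermonde

noncomputable section

/-! ### Counting lattice points in the fibres of an integral linear map -/

section Lattice

/-- The points of `ℝ^ι` whose rescaling by `N` has coordinatewise integer part in `S`. -/
def scaledCells {ι : Type*} (N : ℕ) (S : Set (ι → ℤ)) : Set (ι → ℝ) :=
  {t | (fun i => ⌊(N : ℝ) * t i⌋) ∈ S}

theorem scaledCells_singleton {ι : Type*} {N : ℕ} (hN : 0 < N) (z : ι → ℤ) :
    scaledCells N {z} =
      Set.univ.pi fun i => Set.Ico ((z i : ℝ) / N) ((z i + 1 : ℝ) / N) := by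
  have hN' : (0 : ℝ) < N := by exact_mod_cast hN
  ext t
  simp only [scaledCells, Set.mem_singleton_iff, Set.mem_ofPred_eq, Set.mem_univ_pi, funext_iff,
    Int.floor_eq_iff, Set.mem_Ico, div_le_iff₀ hN', lt_div_iff₀ hN', mul_comm (N : ℝ)]

theorem measurableSet_scaledCells {ι : Type*} [Fintype ι] (N : ℕ) (S : Set (ι → ℤ)) :
    MeasurableSet (scaledCells N S) := by
  have h : Measurable fun t : ι → ℝ => fun i => ⌊(N : ℝ) * t i⌋ := by
    refine measurable_pi_lambda _ fun i => ?_
    exact Int.measurable_floor.comp (measurable_const.mul (measurable_pi_apply i))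
  exact h (Set.to_countable S).measurableSet

/-- The cells are disjoint cubes of side `1/N`. This turns lattice counts into volumes, hence
counting asymptotics into convergence of measures. -/
theorem volume_scaledCells {ι : Type*} [Fintype ι] {N : ℕ} (hN : 0 < N)
    (S : Finset (ι → ℤ)) :
    volume.real (scaledCells N (S : Set (ι → ℤ))) = S.card / (N : ℝ) ^ Fintype.card ι := by
  have hN' : (0 : ℝ) < N := by exact_mod_cast hN
  have hcell : ∀ z : ι → ℤ, volume (scaledCells N {z}) =
      ENNReal.ofReal (((N : ℝ) ^ Fintype.card ι)⁻¹) := by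
    intro z
    rw [scaledCells_singleton hN, Real.volume_pi_Ico]
    have : ∀ i, ENNReal.ofReal ((z i + 1 : ℝ) / N - (z i : ℝ) / N) =
        ENNReal.ofReal ((N : ℝ)⁻¹) := by
      intro i; congr 1; field_simp; ring
    simp only [this, Finset.prod_const, Finset.card_univ]
    rw [← ENNReal.ofReal_pow (by positivity), inv_pow]
  have hunion : scaledCells N (S : Set (ι → ℤ)) = ⋃ z ∈ S, scaledCells N {z} := by
    ext t; simp [scaledCells]
  rw [measureReal_def, hunion, measure_biUnion_finset]
  · simp only [hcell, Finset.sum_const, nsmul_eq_mul, ENNReal.toReal_mul, ENNReal.toReal_natCast]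
    rw [ENNReal.toReal_ofReal (by positivity), div_eq_mul_inv]
  · intro z _ w _ hzw
    refine Set.disjoint_left.2 fun t ht ht' => hzw ?_
    exact (show _ = z from ht).symm.trans ht'
  · exact fun z _ => measurableSet_scaledCells N {z}

/-- The lattice points of the cube `[0, N)^n`. -/
def latticeBox (n N : ℕ) : Finset (Fin n → ℤ) :=
  Fintype.piFinset fun _ => (Finset.range N).map Nat.castEmbedding

theorem mem_latticeBox {n N : ℕ} {k : Fin n → ℤ} :
    k ∈ latticeBox n N ↔ ∀ i, 0 ≤ k i ∧ k i < N := by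
  simp only [latticeBox, Fintype.mem_piFinset, Finset.mem_map, Finset.mem_range,
    Nat.castEmbedding_apply]
  refine forall_congr' fun i => ⟨?_, fun h => ⟨(k i).toNat, ?_, ?_⟩⟩
  · rintro ⟨a, ha, h⟩; omega
  · omega
  · exact Int.toNat_of_nonneg h.1

/-- The number of lattice points of the cube `[0, N)^n` at which `A` takes the value `m`. -/
def fiberCount {n : ℕ} {κ : Type*} [Fintype κ] (A : (Fin n → ℤ) →ₗ[ℤ] (κ → ℤ)) (N : ℕ)
    (m : κ → ℤ) : ℕ :=
  ((latticeBox n N).filter fun k => A k = m).card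

/-- The kernel of a surjective integral linear map, in coordinates: `B` parametrizes the kernel,
`σ` is a section of `A`, and `G` is the retraction onto the kernel along `σ`. -/
theorem exists_kernel_coordinates {n : ℕ} {κ : Type*} [Fintype κ]
    (A : (Fin n → ℤ) →ₗ[ℤ] (κ → ℤ)) (hA : Function.Surjective A) :
    ∃ d : ℕ, n = d + Fintype.card κ ∧ ∃ (B : (Fin d → ℤ) →ₗ[ℤ] (Fin n → ℤ))
      (G : (Fin n → ℤ) →ₗ[ℤ] (Fin d → ℤ)) (σ : (κ → ℤ) →ₗ[ℤ] (Fin n → ℤ)),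
      (∀ z, A (B z) = 0) ∧ (∀ m, A (σ m) = m) ∧ (∀ m, G (σ m) = 0) ∧ (∀ z, G (B z) = z) ∧
      ∀ k, B (G k) + σ (A k) = k := by
  obtain ⟨σ, hσ⟩ := A.exists_rightInverse_of_surjective (LinearMap.range_eq_top.2 hA)
  have hσ' : ∀ m, A (σ m) = m := fun m => LinearMap.congr_fun hσ m
  -- Rank-nullity over `ℤ` fixes the kernel rank `d`; the kernel is free, so a basis of it supplies
  -- `B`.
  have hrank := (LinearMap.ker A).finrank_quotient_add_finrank
  rw [(A.quotKerEquivOfSurjective hA).finrank_eq, Module.finrank_fintype_fun_eq_card,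
    Module.finrank_fintype_fun_eq_card, Fintype.card_fin] at hrank
  let b := Module.finBasis ℤ (LinearMap.ker A)
  let π : (Fin n → ℤ) →ₗ[ℤ] LinearMap.ker A :=
    (LinearMap.id - σ ∘ₗ A).codRestrict _ fun k => by simp [hσ']
  have hπ : ∀ k, (π k : Fin n → ℤ) = k - σ (A k) := fun k => rfl
  refine ⟨Module.finrank ℤ (LinearMap.ker A), by omega,
    (LinearMap.ker A).subtype ∘ₗ b.equivFun.symm.toLinearMap, b.equivFun.toLinearMap ∘ₗ π, σ,
    fun z => ?_, hσ', fun m => ?_, fun z => ?_, fun k => ?_⟩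
  · exact (b.equivFun.symm z).2
  · have : π (σ m) = 0 := Subtype.ext (by rw [hπ, hσ', sub_self]; rfl)
    simp [this]
  · have : π (b.equivFun.symm z : LinearMap.ker A) = b.equivFun.symm z :=
      Subtype.ext (by rw [hπ, (b.equivFun.symm z).2, map_zero, sub_zero])
    simp only [LinearMap.comp_apply, Submodule.subtype_apply, LinearEquiv.coe_coe]
    rw [this, LinearEquiv.apply_symm_apply]
  · simp [hπ]

theorem volume_linear_level_eq_zero {ι : Type*} [Fintype ι] (f : (ι → ℝ) →ₗ[ℝ] ℝ) (hf : f ≠ 0)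
    (c : ℝ) : volume {t | f t = c} = 0 := by
  obtain ⟨v, rfl⟩ := LinearMap.surjective hf c
  have h : {t | f t = f v} = (AffineSubspace.mk' v (LinearMap.ker f) : Set (ι → ℝ)) := by
    ext t
    simp [AffineSubspace.mem_mk', sub_eq_zero]
  rw [h]
  refine Measure.addHaar_affineSubspace _ _ fun htop => hf ?_
  have := congrArg AffineSubspace.direction htop
  rw [AffineSubspace.direction_mk', AffineSubspace.direction_top] at this
  exact LinearMap.ker_eq_top.1 this

/-- The real-linear extension of the `i`-th coordinate of an integral linear map. -/
def realRow {ι κ : Type*} [Fintype ι] [DecidableEq ι] (B : (ι → ℤ) →ₗ[ℤ] (κ → ℤ)) (i : κ) :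
    (ι → ℝ) →ₗ[ℝ] ℝ :=
  ∑ j, ((B (Pi.single j 1) i : ℤ) : ℝ) • LinearMap.proj j

theorem realRow_apply {ι κ : Type*} [Fintype ι] [DecidableEq ι] (B : (ι → ℤ) →ₗ[ℤ] (κ → ℤ))
    (i : κ) (t : ι → ℝ) : realRow B i t = ∑ j, ((B (Pi.single j 1) i : ℤ) : ℝ) * t j := by
  simp [realRow]

theorem realRow_intCast {ι κ : Type*} [Fintype ι] [DecidableEq ι] (B : (ι → ℤ) →ₗ[ℤ] (κ → ℤ))
    (i : κ) (z : ι → ℤ) : realRow B i (fun j => (z j : ℝ)) = (B z i : ℝ) := by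
  rw [realRow_apply, LinearMap.pi_apply_eq_sum_univ B z, Finset.sum_apply]
  push_cast
  refine Finset.sum_congr rfl fun j _ => ?_
  have : (fun i => if j = i then (1 : ℤ) else 0) = Pi.single j 1 := by
    ext i; simp [Pi.single_apply, eq_comm]
  simp [this, mul_comm]

theorem tendsto_floor_mul_div (x : ℝ) :
    Tendsto (fun N : ℕ => (⌊(N : ℝ) * x⌋ : ℝ) / N) atTop (𝓝 x) := by
  have h1 : Tendsto (fun N : ℕ => x - 1 / (N : ℝ)) atTop (𝓝 x) := by
    simpa using tendsto_const_nhds.sub (tendsto_one_div_atTop_nhds_zero_nat (𝕜 := ℝ))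
  refine tendsto_of_tendsto_of_tendsto_of_le_of_le' h1 tendsto_const_nhds ?_ ?_ <;>
    filter_upwards [eventually_gt_atTop 0] with N hN
  all_goals have hN' : (0 : ℝ) < N := by exact_mod_cast hN
  · rw [le_div_iff₀ hN', sub_mul, div_mul_cancel₀ _ hN'.ne', mul_comm x]
    exact (Int.sub_one_lt_floor _).le
  · rw [div_le_iff₀ hN', mul_comm x]
    exact Int.floor_le _

/-- The shift `c` vanishes after division by `N`; this is why all fibres share one leading constant.
-/
theorem tendsto_realRow_floor {ι κ : Type*} [Fintype ι] [DecidableEq ι]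
    (B : (ι → ℤ) →ₗ[ℤ] (κ → ℤ)) (i : κ) (c : ℤ) (t : ι → ℝ) :
    Tendsto (fun N : ℕ => ((B (fun j => ⌊(N : ℝ) * t j⌋) i + c : ℤ) : ℝ) / N) atTop
      (𝓝 (realRow B i t)) := by
  have h : ∀ N : ℕ, ((B (fun j => ⌊(N : ℝ) * t j⌋) i + c : ℤ) : ℝ) / N =
      ∑ j, ((B (Pi.single j 1) i : ℤ) : ℝ) * ((⌊(N : ℝ) * t j⌋ : ℝ) / N) + (c : ℝ) * (1 / N) := by
    intro N
    rw [Int.cast_add, ← realRow_intCast, realRow_apply, add_div, Finset.sum_div]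
    simp only [mul_div_assoc, mul_one_div]
  simp only [h]
  rw [realRow_apply, ← add_zero (∑ j, _)]
  refine (tendsto_finsetSum _ fun j _ => (tendsto_floor_mul_div (t j)).const_mul _).add ?_
  simpa using (tendsto_one_div_atTop_nhds_zero_nat (𝕜 := ℝ)).const_mul (c : ℝ)

/-- The number of lattice points in the fibres of a surjective integral linear map over the cube
`[0, N)^n` has order `N^d`, with the same leading coefficient for all fibres, as soon as the kernel
contains the diagonal. -/
theorem exists_tendsto_fiberCount {n : ℕ} {κ : Type*} [Fintype κ]
    (A : (Fin n → ℤ) →ₗ[ℤ] (κ → ℤ)) (hA : Function.Surjective A) (h1 : A (fun _ => 1) = 0) :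
    ∃ d : ℕ, n = d + Fintype.card κ ∧ ∃ V C : ℝ,
      (∀ N m, 0 < N → (fiberCount A N m : ℝ) / (N : ℝ) ^ d ≤ C) ∧
      ∀ m, Tendsto (fun N => (fiberCount A N m : ℝ) / (N : ℝ) ^ d) atTop (𝓝 V) := by
  obtain ⟨d, hd, B, G, σ, hAB, hAσ, hGσ, hGB, hBG⟩ := exists_kernel_coordinates A hA
  -- The fibre in kernel coordinates: `G` is injective on it, with inverse `z ↦ B z + σ m`.
  let S : ℕ → (κ → ℤ) → Finset (Fin d → ℤ) := fun N m =>
    ((latticeBox n N).filter fun k => A k = m).image G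
  have hSmem : ∀ N m z, z ∈ S N m ↔ B z + σ m ∈ latticeBox n N := by
    intro N m z
    simp only [S, Finset.mem_image, Finset.mem_filter]
    constructor
    · rintro ⟨k, ⟨hk, rfl⟩, rfl⟩
      rwa [hBG]
    · intro h
      refine ⟨B z + σ m, ⟨h, ?_⟩, ?_⟩
      · rw [map_add, hAB, hAσ, zero_add]
      · rw [map_add, hGB, hGσ, add_zero]
  have hcard : ∀ N m, fiberCount A N m = (S N m).card := by
    intro N m
    rw [Finset.card_image_of_injOn, fiberCount]
    intro k hk l hl hkl
    simp only [Finset.coe_filter, Set.mem_ofPred_eq] at hk hl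
    rw [← hBG k, ← hBG l, hk.2, hl.2, hkl]
  have hvol : ∀ N m, 0 < N → volume.real (scaledCells N (S N m : Set (Fin d → ℤ))) =
      (fiberCount A N m : ℝ) / (N : ℝ) ^ d := by
    intro N m hN
    rw [volume_scaledCells hN, hcard, Fintype.card_fin]
  obtain ⟨R, hR⟩ : ∃ R : ℝ, ∀ (k : Fin n → ℤ) (N : ℕ), k ∈ latticeBox n N → ∀ j,
      |(G k j : ℝ)| ≤ R * N := by
    refine ⟨∑ j, ∑ i, |((G (Pi.single i 1) j : ℤ) : ℝ)|, fun k N hk j => ?_⟩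
    rw [← realRow_intCast, realRow_apply]
    refine (Finset.abs_sum_le_sum_abs _ _).trans ?_
    refine le_trans ?_ (mul_le_mul_of_nonneg_right (Finset.single_le_sum
      (f := fun j => ∑ i, |((G (Pi.single i 1) j : ℤ) : ℝ)|)
      (fun j _ => Finset.sum_nonneg fun i _ => abs_nonneg _) (Finset.mem_univ j))
      (Nat.cast_nonneg N))
    rw [Finset.sum_mul]
    refine Finset.sum_le_sum fun i _ => ?_
    rw [abs_mul]
    have := mem_latticeBox.1 hk i
    refine mul_le_mul_of_nonneg_left ?_ (abs_nonneg _)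
    rw [abs_of_nonneg (by exact_mod_cast this.1)]
    exact_mod_cast this.2.le
  -- This box works for every `m` because `G` kills `σ m`. The extra `1` absorbs the fractional part
  -- lost to the floor.
  let Q : Set (Fin d → ℝ) := Set.univ.pi fun _ => Set.Icc (-R) (R + 1)
  have hQfin : volume Q ≠ ⊤ :=
     (isCompact_univ_pi fun _ => isCompact_Icc).measure_lt_top.ne
  have hQ : ∀ N m, 0 < N → scaledCells N (S N m : Set (Fin d → ℤ)) ⊆ Q := by
    intro N m hN t ht j _
    have hN' : (0 : ℝ) < N := by exact_mod_cast hN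
    have hN1 : (1 : ℝ) ≤ N := by exact_mod_cast hN
    have hz : (fun i => ⌊(N : ℝ) * t i⌋) ∈ S N m := ht
    have hb := hR _ N ((hSmem _ _ _).1 hz) j
    rw [map_add, hGB, hGσ, add_zero, abs_le] at hb
    have hl := Int.floor_le ((N : ℝ) * t j)
    have hu := Int.lt_floor_add_one ((N : ℝ) * t j)
    constructor <;> nlinarith
  -- The limiting polytope, free of `m`; its volume is the constant `V`.
  let P : Set (Fin d → ℝ) := {t | ∀ i, 0 ≤ realRow B i t ∧ realRow B i t ≤ 1}
  have hcont : ∀ i, Continuous (realRow B i) := fun i => LinearMap.continuous_of_finiteDimensional _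
  have hP : MeasurableSet P := by
    have : IsClosed P := by
      simp only [P, Set.ofPred_forall]
      exact isClosed_iInter fun i => (isClosed_le continuous_const (hcont i)).inter
        (isClosed_le (hcont i) continuous_const)
    exact this.measurableSet
  -- The all-ones vector is in the kernel, so `B` attains it and no row of `B` vanishes. Hence the
  -- faces of `P` are null sets.
  have hrow : ∀ i, realRow B i ≠ 0 := by
    intro i h
    have h2 := realRow_intCast B i (G fun _ => 1)
    have h3 := hBG fun _ => 1
    rw [h1, map_zero, add_zero] at h3
    rw [h3, h] at h2
    simp at h2
  refine ⟨d, hd, volume.real P, volume.real Q, fun N m hN => ?_, fun m => ?_⟩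
  · rw [← hvol N m hN]
    exact measureReal_mono (hQ N m hN) hQfin
  have hlim : Tendsto (fun N : ℕ => volume (scaledCells N (S N m : Set (Fin d → ℤ)))) atTop
      (𝓝 (volume P)) := by
    refine tendsto_measure_of_ae_tendsto_indicator atTop hP
      (fun N => measurableSet_scaledCells N _)
      (MeasurableSet.univ_pi fun _ => measurableSet_Icc) hQfin
      ((eventually_gt_atTop 0).mono fun N hN => hQ N m hN) ?_
    have hne : ∀ᵐ t : Fin d → ℝ, ∀ i, realRow B i t ≠ 0 ∧ realRow B i t ≠ 1 := by
      refine ae_all_iff.2 fun i => ?_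
      filter_upwards [compl_mem_ae_iff.2 (volume_linear_level_eq_zero _ (hrow i) 0),
        compl_mem_ae_iff.2 (volume_linear_level_eq_zero _ (hrow i) 1)] with t h0 h1
      exact ⟨h0, h1⟩
    filter_upwards [hne] with t ht
    have hmem : ∀ N : ℕ, 0 < N → (t ∈ scaledCells N (S N m : Set (Fin d → ℤ)) ↔
        ∀ i, 0 ≤ ((B (fun j => ⌊(N : ℝ) * t j⌋) i + σ m i : ℤ) : ℝ) / N ∧
          ((B (fun j => ⌊(N : ℝ) * t j⌋) i + σ m i : ℤ) : ℝ) / N < 1) := by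
      intro N hN
      have hN' : (0 : ℝ) < N := by exact_mod_cast hN
      rw [show t ∈ scaledCells N (S N m : Set (Fin d → ℤ)) ↔
        (fun i => ⌊(N : ℝ) * t i⌋) ∈ S N m from Iff.rfl, hSmem, mem_latticeBox]
      refine forall_congr' fun i => ?_
      rw [le_div_iff₀ hN', div_lt_one hN', zero_mul, Pi.add_apply]
      norm_cast
    have htend := fun i => tendsto_realRow_floor B i (σ m i) t
    by_cases htP : t ∈ P
    · have hev := eventually_all.2 fun i => ((htend i).eventually_const_lt
        (lt_of_le_of_ne (htP i).1 (ht i).1.symm)).and ((htend i).eventually_lt_const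
        (lt_of_le_of_ne (htP i).2 (ht i).2))
      filter_upwards [hev, eventually_gt_atTop 0] with N h hN
      exact iff_of_true ((hmem N hN).2 fun i => ⟨(h i).1.le, (h i).2⟩) htP
    · have : ∃ i, realRow B i t < 0 ∨ 1 < realRow B i t := by
        by_contra! hcon
        exact htP fun i => hcon i
      obtain ⟨i, hi⟩ := this
      rcases hi with hi | hi
      · filter_upwards [(htend i).eventually_lt_const hi, eventually_gt_atTop 0] with N h hN
        exact iff_of_false (fun hc => absurd ((hmem N hN).1 hc i).1 (not_le.2 h)) htP
      · filter_upwards [(htend i).eventually_const_lt hi, eventually_gt_atTop 0] with N h hN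
        exact iff_of_false (fun hc => absurd ((hmem N hN).1 hc i).2 (not_lt.2 h.le)) htP
  have hPfin : volume P ≠ ⊤ := by
    refine ne_top_of_le_ne_top hQfin (le_of_tendsto hlim ?_)
    filter_upwards [eventually_gt_atTop 0] with N hN
    exact measure_mono (hQ N m hN)
  refine ((ENNReal.tendsto_toReal hPfin).comp hlim).congr' ?_
  filter_upwards [eventually_gt_atTop 0] with N hN
  exact hvol N m hN

end Lattice

/-! ### Fourier coefficients of a product, by Parseval -/

section Convolution

/-- The Fourier integral of `f` over `[-π, π]`. -/
def phaseIntegral (f : ℝ → ℂ) (m : ℤ) : ℂ :=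
  ∫ t, Complex.exp (-Complex.I * (m : ℂ) * (t : ℂ)) * f t ∂lebesgueOnPhases

instance : IsFiniteMeasure lebesgueOnPhases := by
  unfold lebesgueOnPhases; infer_instance

theorem lebesgueOnPhases_eq_restrict_Ioc :
    lebesgueOnPhases = volume.restrict (Set.Ioc (-Real.pi) Real.pi) :=
  restrict_Ioc_eq_restrict_Icc.symm

theorem integral_lebesgueOnPhases {E : Type*} [NormedAddCommGroup E] [NormedSpace ℝ E]
    (f : ℝ → E) : ∫ t, f t ∂lebesgueOnPhases = ∫ t in (-Real.pi)..Real.pi, f t := by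
  rw [intervalIntegral.integral_of_le (by linarith [Real.pi_pos]), lebesgueOnPhases_eq_restrict_Ioc]

instance fact_two_pi_pos : Fact (0 < 2 * Real.pi) := ⟨Real.two_pi_pos⟩

/-- The function on the circle `ℝ / 2πℤ` that agrees with `f` on `(-π, π]`. -/
def onCircle (f : ℝ → ℂ) : AddCircle (2 * Real.pi) → ℂ :=
  AddCircle.liftIoc (2 * Real.pi) (-Real.pi) f

theorem neg_pi_add_two_pi : -Real.pi + 2 * Real.pi = Real.pi := by ring

theorem memLp_onCircle {f : ℝ → ℂ} {q : ENNReal} (hf : MemLp f q lebesgueOnPhases) :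
    MemLp (onCircle f) q AddCircle.haarAddCircle := by
  refine MemLp.haarAddCircle (MemLp.memLp_liftIoc ?_)
  rwa [neg_pi_add_two_pi, ← lebesgueOnPhases_eq_restrict_Ioc]

theorem integral_onCircle (f : ℝ → ℂ) :
    ∫ t, onCircle f t ∂AddCircle.haarAddCircle =
      (2 * Real.pi : ℂ)⁻¹ * ∫ t, f t ∂lebesgueOnPhases := by
  rw [AddCircle.integral_haarAddCircle, onCircle, AddCircle.integral_liftIoc_eq_intervalIntegral,
    neg_pi_add_two_pi, integral_lebesgueOnPhases, Complex.real_smul]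
  push_cast
  rfl

theorem fourierCoeff_onCircle (f : ℝ → ℂ) (l : ℤ) :
    fourierCoeff (onCircle f) l = (2 * Real.pi : ℂ)⁻¹ * phaseIntegral f l := by
  rw [phaseIntegral, ← integral_onCircle, fourierCoeff]
  congr 1
  ext t
  obtain ⟨⟨x, hx⟩, rfl⟩ := (AddCircle.equivIoc (2 * Real.pi) (-Real.pi)).symm.surjective t
  change fourier (-l) (x : AddCircle (2 * Real.pi)) • onCircle f x = onCircle _ x
  rw [onCircle, onCircle, AddCircle.liftIoc_coe_apply hx, AddCircle.liftIoc_coe_apply hx,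
    fourier_coe_apply, smul_eq_mul]
  congr 2
  have : (Real.pi : ℂ) ≠ 0 := by exact_mod_cast Real.pi_ne_zero
  push_cast
  field_simp

/-- Parseval for `star F` and `G`: conjugating the `l`-th coefficient of `star F` gives the
coefficient of `F` at `-l`. -/
theorem hasSum_fourierCoeff_mul {T : ℝ} [Fact (0 < T)] {F G : AddCircle T → ℂ}
    (hF : MemLp F 2 AddCircle.haarAddCircle) (hG : MemLp G 2 AddCircle.haarAddCircle) :
    HasSum (fun l : ℤ => fourierCoeff F (-l) * fourierCoeff G l)
      (∫ t, F t * G t ∂AddCircle.haarAddCircle) := by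
  have hF' : MemLp (star F) 2 AddCircle.haarAddCircle := hF.star
  have hrepr : ∀ {H : AddCircle T → ℂ} (hH : MemLp H 2 AddCircle.haarAddCircle) (l : ℤ),
      inner ℂ (fourierBasis l) (hH.toLp H) = fourierCoeff H l := by
    intro H hH l
    rw [← fourierBasis.repr_apply_apply, fourierBasis_repr]
    exact congrFun (fourierCoeff_congr_ae hH.coeFn_toLp) l
  have hinner : inner ℂ (hF'.toLp (star F)) (hG.toLp G) =
      ∫ t, F t * G t ∂AddCircle.haarAddCircle := by
    rw [L2.inner_def]
    refine integral_congr_ae ?_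
    filter_upwards [hF'.coeFn_toLp, hG.coeFn_toLp] with t h1 h2
    rw [h1, h2]
    simp [mul_comm]
  rw [← hinner]
  convert! fourierBasis.hasSum_inner_mul_inner (hF'.toLp (star F)) (hG.toLp G) using 1
  ext l
  rw [hrepr, ← inner_conj_symm, hrepr]
  congr 1
  rw [fourierCoeff, fourierCoeff, ← integral_conj]
  congr 1
  ext t
  simp only [smul_eq_mul, map_mul, Pi.star_apply, RCLike.star_def, Complex.conj_conj,
    ← fourier_neg]

/-- The convolution theorem for the Fourier coefficients of a product of square integrable
functions. -/
theorem hasSum_phaseIntegral_mul {f g : ℝ → ℂ} (hf : MemLp f 2 lebesgueOnPhases)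
    (hg : MemLp g 2 lebesgueOnPhases) (m : ℤ) :
    HasSum (fun l : ℤ => phaseIntegral f l * phaseIntegral g (m - l))
      (2 * Real.pi * phaseIntegral (fun t => f t * g t) m) := by
  have hpi : (Real.pi : ℂ) ≠ 0 := by exact_mod_cast Real.pi_ne_zero
  -- Twisting `g` by this character shifts its coefficients by `m`, reducing the claim to Parseval.
  let e : ℝ → ℂ := fun t => Complex.exp (-Complex.I * (m : ℂ) * (t : ℂ))
  have he : Continuous e := by fun_prop
  have hnorm : ∀ t, ‖e t‖ = 1 := by
    intro t
    rw [show e t = Complex.exp (((-(m : ℝ) * t : ℝ) : ℂ) * Complex.I) by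
      simp only [e]; congr 1; push_cast; ring]
    exact Complex.norm_exp_ofReal_mul_I _
  have hg' : MemLp (fun t => e t * g t) 2 lebesgueOnPhases := by
    refine hg.of_le (he.aestronglyMeasurable.mul hg.1) (ae_of_all _ fun t => ?_)
    rw [norm_mul, hnorm, one_mul]
  have hshift : ∀ l, phaseIntegral (fun t => e t * g t) l = phaseIntegral g (m + l) := by
    intro l
    simp only [phaseIntegral, e]
    congr 1
    ext t
    rw [← mul_assoc, ← Complex.exp_add]
    congr 2
    push_cast
    ring
  have h := hasSum_fourierCoeff_mul (memLp_onCircle hf) (memLp_onCircle hg')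
  have hprod : (∫ t, onCircle f t * onCircle (fun t => e t * g t) t ∂AddCircle.haarAddCircle) =
      (2 * Real.pi : ℂ)⁻¹ * phaseIntegral (fun t => f t * g t) m := by
    rw [phaseIntegral, ← integral_onCircle]
    congr 1
    ext t
    simp only [onCircle, AddCircle.liftIoc, Function.comp_apply, Set.domRestrict_apply, e]
    ring
  simp only [fourierCoeff_onCircle, hprod, hshift] at h
  have h2 := (Equiv.neg ℤ).hasSum_iff.2 (h.mul_left ((2 * Real.pi : ℂ) ^ 2))
  rw [show (2 * Real.pi : ℂ) ^ 2 * ((2 * Real.pi : ℂ)⁻¹ * phaseIntegral (fun t => f t * g t) m) =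
    2 * Real.pi * phaseIntegral (fun t => f t * g t) m by field_simp] at h2
  convert! h2 using 1
  ext l
  simp only [Function.comp_apply, Equiv.neg_apply, neg_neg, ← sub_eq_add_neg]
  field_simp

end Convolution

/-! ### Convolution powers and the moments of the density -/

section ConvolutionPowers

/-- Unfolding one convolution at a time gives iterated sums; nonnegativity merges them into one
summable family. -/
theorem hasSum_iterated_convolution {φ : ℤ → ℝ} (hφ : ∀ m, 0 ≤ φ m) {c : ℕ → ℤ → ℝ}
    (h0 : ∀ s, c 0 s = φ s)
    (hc : ∀ k s, HasSum (fun l => φ l * c k (s - l)) (c (k + 1) s)) (k : ℕ) :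
    ∀ s, HasSum (fun m : Fin k → ℤ => φ (s - ∑ i, m i) * ∏ i, φ (m i)) (c k s) := by
  induction k with
  | zero =>
    intro s
    simp [h0]
  | succ k ih =>
    intro s
    let f : ℤ × (Fin k → ℤ) → ℝ := fun q => φ q.1 * (φ (s - q.1 - ∑ i, q.2 i) * ∏ i, φ (q.2 i))
    have hf : 0 ≤ f := fun q =>
      mul_nonneg (hφ _) (mul_nonneg (hφ _) (Finset.prod_nonneg fun i _ => hφ _))
    have hin : ∀ l, HasSum (fun m => f (l, m)) (φ l * c k (s - l)) :=
      fun l => (ih (s - l)).mul_left (φ l)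
    have hsum : Summable f := by
      refine (summable_prod_of_nonneg hf).2 ⟨fun l => (hin l).summable, ?_⟩
      simpa only [(hin _).tsum_eq] using (hc k s).summable
    have hfs : HasSum f (c (k + 1) s) := by
      rw [((hsum.hasSum.prod_fiberwise hin).unique (hc k s)).symm]
      exact hsum.hasSum
    rw [← (Fin.consEquiv fun _ => ℤ).hasSum_iff]
    convert hfs using 1
    ext q
    simp only [Function.comp_apply, f, Fin.consEquiv_apply, Fin.sum_univ_succ, Fin.prod_univ_succ,
      Fin.cons_zero, Fin.cons_succ]
    rw [sub_add_eq_sub_sub]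
    ring

/-- Hölder with exponents `2q, 2q`; each further power doubles the exponent needed, so all finite
exponents are used. -/
theorem memLp_pow {p : ℝ → ℝ} {μ : Measure ℝ}
    (hp : ∀ q : NNReal, 1 ≤ q → MemLp p (q : ENNReal) μ) (k : ℕ) (q : NNReal) (hq : 1 ≤ q) :
    MemLp (fun t => p t ^ (k + 1)) (q : ENNReal) μ := by
  induction k generalizing q with
  | zero => simpa using hp q hq
  | succ k ih =>
    have h2 : 1 ≤ 2 * q := by
      calc (1 : NNReal) ≤ 2 * 1 := by norm_num
        _ ≤ 2 * q := by gcongr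
    have : ENNReal.HolderTriple ((2 * q : NNReal) : ENNReal) ((2 * q : NNReal) : ENNReal)
        (q : ENNReal) := by
      have hq0 : q ≠ 0 := (zero_lt_one.trans_le hq).ne'
      constructor
      rw [← ENNReal.coe_inv (by positivity), ← ENNReal.coe_inv hq0, ← ENNReal.coe_add]
      congr 1
      field_simp
      norm_num
    simpa only [pow_succ _ (k + 1)] using (hp _ h2).mul' (ih _ h2)

/-- The Fourier coefficients of the powers of a density are the convolution powers of its Fourier
coefficients. -/
theorem hasSum_density_coefficients {κ : Type*} [Fintype κ] {p : ℝ → ℝ} {φ : ℤ → ℝ}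
    (hp : ∀ q : NNReal, 1 ≤ q → MemLp p (q : ENNReal) lebesgueOnPhases) (hφ : ∀ m, 0 ≤ φ m)
    (hφp : ∀ m, phaseIntegral (fun t => (p t : ℂ)) m = φ m) :
    HasSum (fun m : κ → ℤ => φ (-∑ i, m i) * ∏ i, φ (m i))
      ((2 * Real.pi) ^ Fintype.card κ *
        ∫ x in (-Real.pi)..Real.pi, p x ^ (Fintype.card κ + 1)) := by
  let c : ℕ → ℤ → ℝ := fun k s =>
    (2 * Real.pi) ^ k * (phaseIntegral (fun t => ((p t ^ (k + 1) : ℝ) : ℂ)) s).re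
  have h0 : ∀ s, c 0 s = φ s := by
    intro s
    simp only [c, zero_add, pow_one, pow_zero, one_mul, hφp, Complex.ofReal_re]
  have hc : ∀ k s, HasSum (fun l => φ l * c k (s - l)) (c (k + 1) s) := by
    intro k s
    have h1 : MemLp (fun t => (p t : ℂ)) 2 lebesgueOnPhases := by
      exact_mod_cast (hp 2 (by norm_num)).ofReal (K := ℂ)
    have h2 : MemLp (fun t => ((p t ^ (k + 1) : ℝ) : ℂ)) 2 lebesgueOnPhases := by
      exact_mod_cast (memLp_pow hp k 2 (by norm_num)).ofReal (K := ℂ)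
    have h := (Complex.reCLM.hasSum (hasSum_phaseIntegral_mul h1 h2 s)).mul_left
      ((2 * Real.pi) ^ k)
    convert! h using 1
    · ext l
      simp only [c, hφp, Complex.reCLM_apply, Complex.re_ofReal_mul]
      ring
    · have : (fun t => (p t : ℂ) * ((p t ^ (k + 1) : ℝ) : ℂ)) =
          fun t => ((p t ^ (k + 1 + 1) : ℝ) : ℂ) := by
        ext t; push_cast; ring
      have h2pi : (2 * Real.pi : ℂ) = ((2 * Real.pi : ℝ) : ℂ) := by push_cast; rfl
      simp only [c, this, h2pi, Complex.reCLM_apply, Complex.re_ofReal_mul]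
      ring
  have h := hasSum_iterated_convolution hφ h0 hc (Fintype.card κ) 0
  rw [← ((Fintype.equivFin κ).arrowCongr (Equiv.refl ℤ)).hasSum_iff] at h
  convert h using 1
  · ext m
    simp only [Function.comp_apply, Equiv.arrowCongr_apply, Equiv.coe_refl, id, zero_sub]
    rw [(Fintype.equivFin κ).symm.sum_comp m, (Fintype.equivFin κ).symm.prod_comp fun i => φ (m i)]
  · rw [← integral_lebesgueOnPhases]
    simp only [c, phaseIntegral, Int.cast_zero, mul_zero, zero_mul, Complex.exp_zero, one_mul,
      integral_complex_ofReal, Complex.ofReal_re]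

end ConvolutionPowers

/-! ### Averages over the cube -/

section Averages

/-- Averages over the cube `[0, N)^n` of a nonnegative summable function of `A k`. -/
theorem exists_tendsto_box_average {n : ℕ} {κ : Type*} [Fintype κ]
    (A : (Fin n → ℤ) →ₗ[ℤ] (κ → ℤ)) (hA : Function.Surjective A) (h1 : A (fun _ => 1) = 0) :
    ∃ d : ℕ, n = d + Fintype.card κ ∧ ∃ V : ℝ, ∀ (w : (κ → ℤ) → ℝ) (W : ℝ),
      (∀ m, 0 ≤ w m) → HasSum w W →
      Tendsto (fun N : ℕ => (∑ k ∈ latticeBox n N, w (A k)) / (N : ℝ) ^ d) atTop (𝓝 (V * W)) := by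
  obtain ⟨d, hd, V, C, hC, hV⟩ := exists_tendsto_fiberCount A hA h1
  refine ⟨d, hd, V, fun w W hw hW => ?_⟩
  -- Grouping the points `k` by the value of `A k` prepares dominated convergence with majorant `C *
  -- w m`.
  have hsum : ∀ N : ℕ, (∑ k ∈ latticeBox n N, w (A k)) / (N : ℝ) ^ d =
      ∑' m, (fiberCount A N m : ℝ) / (N : ℝ) ^ d * w m := by
    intro N
    have h : ∀ m, (fiberCount A N m : ℝ) / (N : ℝ) ^ d * w m =
        (∑ k ∈ latticeBox n N, if m = A k then w (A k) else 0) / (N : ℝ) ^ d := by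
      intro m
      rw [fiberCount, Finset.card_filter]
      push_cast
      rw [div_mul_eq_mul_div, Finset.sum_mul]
      congr 1
      refine Finset.sum_congr rfl fun k _ => ?_
      by_cases hk : A k = m
      · simp [hk]
      · simp [hk, Ne.symm hk]
    simp only [h]
    rw [tsum_div_const, Summable.tsum_finsetSum]
    · simp only [tsum_ite_eq]
    · exact fun k _ => (hasSum_ite_eq (A k) (w (A k))).summable
  simp only [hsum]
  rw [mul_comm, ← hW.tsum_eq, ← tsum_mul_right]
  simp only [mul_comm _ V]
  refine tendsto_tsum_of_dominated_convergence (hW.summable.mul_left C)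
    (fun m => (hV m).mul_const _) ?_
  filter_upwards [eventually_gt_atTop 0] with N hN m
  rw [Real.norm_of_nonneg (mul_nonneg (by positivity) (hw m))]
  exact mul_le_mul_of_nonneg_right (hC N m hN) (hw m)

end Averages

/-! ### The flux of a closed walk through the blocks -/

section CyclicFlux

variable {n : ℕ} [NeZero n] {β : Type*} [DecidableEq β]

/-- The net flux of the edge weights `k` into each vertex, for the closed walk
`c 0, c 1, …, c (n - 1), c 0`. -/
def cyclicFlux (c : Fin n → β) : (Fin n → ℤ) →ₗ[ℤ] (β → ℤ) :=
  LinearMap.pi fun b =>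
    ∑ j, ((if c (j + 1) = b then 1 else 0) - (if c j = b then 1 else 0) : ℤ) • LinearMap.proj j

theorem cyclicFlux_apply (c : Fin n → β) (k : Fin n → ℤ) (b : β) :
    cyclicFlux c k b =
      ∑ j, ((if c (j + 1) = b then 1 else 0) - (if c j = b then 1 else 0) : ℤ) * k j := by
  simp only [cyclicFlux, LinearMap.pi_apply, LinearMap.sum_apply, LinearMap.smul_apply,
    LinearMap.proj_apply, smul_eq_mul]

theorem sum_comp_add_one {M : Type*} [AddCommMonoid M] (f : Fin n → M) :
    ∑ j, f (j + 1) = ∑ j, f j :=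
  Equiv.sum_comp (Equiv.addRight (1 : Fin n)) f

theorem cyclicFlux_one (c : Fin n → β) : cyclicFlux c (fun _ => 1) = 0 := by
  ext b
  simp only [cyclicFlux_apply, mul_one, Finset.sum_sub_distrib, Pi.zero_apply]
  rw [sum_comp_add_one fun j => if c j = b then (1 : ℤ) else 0, sub_self]

theorem sum_cyclicFlux_mul {R : Type*} [CommRing R] [Fintype β] (c : Fin n → β)
    (k : Fin n → ℤ) (x : β → R) :
    ∑ b, (cyclicFlux c k b : R) * x b = ∑ j, (k j : R) * (x (c (j + 1)) - x (c j)) := by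
  simp only [cyclicFlux_apply, Int.cast_sum, Finset.sum_mul]
  rw [Finset.sum_comm]
  refine Finset.sum_congr rfl fun j _ => ?_
  push_cast
  simp only [sub_mul, Finset.sum_sub_distrib, ite_mul, one_mul, zero_mul, Finset.sum_ite_eq,
    Finset.mem_univ, if_true]
  ring

theorem sum_cyclicFlux [Fintype β] (c : Fin n → β) (k : Fin n → ℤ) :
    ∑ b, cyclicFlux c k b = 0 := by
  simpa using sum_cyclicFlux_mul (R := ℤ) c k fun _ => 1

theorem cyclicFlux_single (c : Fin n → β) (j : Fin n) :
    cyclicFlux c (Pi.single j 1) = Pi.single (c (j + 1)) 1 - Pi.single (c j) 1 := by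
  ext b
  rw [cyclicFlux_apply, Finset.sum_eq_single j]
  · simp [Pi.single_apply, eq_comm]
  · intro i _ hi
    simp [hi]
  · simp

/-- Unit weights on the first `j` edges of the walk telescope. -/
theorem exists_cyclicFlux_eq (c : Fin n → β) (j : Fin n) :
    ∃ k, cyclicFlux c k = Pi.single (c j) 1 - Pi.single (c 0) 1 := by
  suffices h : ∀ j : ℕ, ∃ k,
      cyclicFlux c k = Pi.single (c (Fin.ofNat n j)) 1 - Pi.single (c 0) 1 by
    simpa using h j
  intro j
  induction j with
  | zero => exact ⟨0, by rw [map_zero]; exact (sub_self _).symm⟩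
  | succ j ih =>
    obtain ⟨k, hk⟩ := ih
    refine ⟨Pi.single (Fin.ofNat n j) 1 + k, ?_⟩
    have : Fin.ofNat n (j + 1) = Fin.ofNat n j + 1 := by
      ext
      simp [Fin.val_add]
    rw [map_add, cyclicFlux_single, hk, this, sub_add_sub_cancel]

/-- The flux into the vertices other than the starting point of the walk. -/
def reducedFlux (c : Fin n → β) : (Fin n → ℤ) →ₗ[ℤ] ({b // b ≠ c 0} → ℤ) :=
  LinearMap.funLeft ℤ ℤ Subtype.val ∘ₗ cyclicFlux c

theorem reducedFlux_apply (c : Fin n → β) (k : Fin n → ℤ) (b : {b // b ≠ c 0}) :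
    reducedFlux c k b = cyclicFlux c k b := rfl

theorem reducedFlux_one (c : Fin n → β) : reducedFlux c (fun _ => 1) = 0 := by
  rw [reducedFlux, LinearMap.comp_apply, cyclicFlux_one, map_zero]

theorem reducedFlux_surjective [Fintype β] {c : Fin n → β} (hc : Function.Surjective c) :
    Function.Surjective (reducedFlux c) := by
  have h : ∀ b : {b // b ≠ c 0}, ∃ k, reducedFlux c k = Pi.single b 1 := by
    rintro ⟨b, hb⟩
    obtain ⟨j, rfl⟩ := hc b
    obtain ⟨k, hk⟩ := exists_cyclicFlux_eq c j
    refine ⟨k, ?_⟩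
    ext ⟨b', hb'⟩
    rw [reducedFlux_apply, hk]
    simp [Pi.single_apply, hb', Subtype.ext_iff]
  choose k hk using h
  intro m
  refine ⟨∑ b, m b • k b, ?_⟩
  simp only [map_sum, map_smul, hk]
  ext b
  simp [Pi.single_apply]

/-- Total flux is zero, so the flux into the base vertex is minus the sum of the others. -/
theorem prod_cyclicFlux [Fintype β] (c : Fin n → β) (φ : ℤ → ℝ) (k : Fin n → ℤ) :
    ∏ b, φ (cyclicFlux c k b) =
      φ (-∑ b, reducedFlux c k b) * ∏ b, φ (reducedFlux c k b) := by
  rw [Fintype.prod_eq_mul_prod_subtype_ne _ (c 0)]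
  congr 2
  have := sum_cyclicFlux c k
  rw [Fintype.sum_eq_add_sum_subtype_ne _ (c 0)] at this
  exact eq_neg_of_add_eq_zero_left this

end CyclicFlux

/-! ### Expanding the kernel product into characters -/

section Kernel

/-- A geometric sum in `z²`, `z = e^{ix/2}`. Where `sin(x/2) = 0`, `z = ±1` and every summand is
`1`, which matches the continuous extension. -/
theorem exp_mul_sum_exp (N : ℕ) (x : ℝ) :
    Complex.exp (Complex.I / 2 * x) *
        ∑ k ∈ Finset.range N, Complex.exp (Complex.I * k * x) =
      Complex.exp (N * (Complex.I / 2 * x)) * kernelF N x := by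
  set z := Complex.exp (Complex.I / 2 * x) with hz
  have hz0 : z ≠ 0 := Complex.exp_ne_zero _
  have hw : Complex.exp (N * (Complex.I / 2 * x)) = z ^ N := Complex.exp_nat_mul _ _
  have hsum : ∀ k : ℕ, Complex.exp (Complex.I * k * x) = (z ^ 2) ^ k := by
    intro k
    rw [hz, ← Complex.exp_nat_mul, ← Complex.exp_nat_mul]
    congr 1
    push_cast
    ring
  have hcos : 2 * (Real.cos (x / 2) : ℂ) = z + z⁻¹ := by
    rw [Complex.ofReal_cos, Complex.two_cos, hz, ← Complex.exp_neg]
    congr 2 <;> (push_cast; ring)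
  have hsin : 2 * Complex.I * (Real.sin (x / 2) : ℂ) = z - z⁻¹ := by
    rw [Complex.ofReal_sin, mul_right_comm, Complex.two_sin, mul_assoc, Complex.I_mul_I, hz,
      ← Complex.exp_neg, mul_neg_one, neg_sub]
    congr 2 <;> (push_cast; ring)
  have hcosN : 2 * (Real.cos (N / 2 * x) : ℂ) = z ^ N + (z ^ N)⁻¹ := by
    rw [Complex.ofReal_cos, Complex.two_cos, ← hw, ← Complex.exp_neg]
    congr 2 <;> (push_cast; ring)
  have hsinN : 2 * Complex.I * (Real.sin (N / 2 * x) : ℂ) = z ^ N - (z ^ N)⁻¹ := by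
    rw [Complex.ofReal_sin, mul_right_comm, Complex.two_sin, mul_assoc, Complex.I_mul_I, ← hw,
      ← Complex.exp_neg, mul_neg_one, neg_sub]
    congr 2 <;> (push_cast; ring)
  rw [hw]
  simp only [hsum]
  unfold kernelF
  split_ifs with h
  · rw [h, Complex.ofReal_zero, mul_zero, eq_comm, sub_eq_zero] at hsin
    have hz2 : z ^ 2 = 1 := by
      rw [sq]; nth_rewrite 2 [hsin]; exact mul_inv_cancel₀ hz0
    rw [← hsin] at hcos
    rw [← inv_pow, ← hsin] at hcosN
    have hc : (Real.cos (x / 2) : ℂ) = z := by linear_combination hcos / 2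
    have hcN : (Real.cos (N / 2 * x) : ℂ) = z ^ N := by linear_combination hcosN / 2
    have hzN : z ^ N * z ^ N = 1 := by rw [← pow_add, ← two_mul, pow_mul, hz2, one_pow]
    rw [Complex.ofReal_div, Complex.ofReal_mul, hc, hcN, hz2, Complex.ofReal_natCast]
    simp only [one_pow, Finset.sum_const, Finset.card_range, nsmul_eq_mul, mul_one]
    field_simp
    linear_combination (N : ℂ) * hz2 - (N : ℂ) * hzN
  · have hs : (Real.sin (x / 2) : ℂ) ≠ 0 := by exact_mod_cast h
    have hg := geom_sum_mul (z ^ 2) N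
    have h1 : z ^ 2 - 1 = 2 * Complex.I * (Real.sin (x / 2) : ℂ) * z := by
      rw [hsin]; field_simp
    have h2 : (z ^ 2) ^ N - 1 = 2 * Complex.I * (Real.sin (N / 2 * x) : ℂ) * z ^ N := by
      rw [hsinN]; field_simp; ring
    rw [h1, h2] at hg
    rw [Complex.ofReal_div, mul_div_assoc', eq_div_iff hs]
    refine mul_left_cancel₀ (mul_ne_zero two_ne_zero Complex.I_ne_zero) ?_
    linear_combination hg

variable {n : ℕ} [NeZero n]

/-- The differences around the cycle sum to zero, so the half-angle phases multiply to `1`. -/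
theorem prod_kernelF_cyclic {β : Type*} (c : Fin n → β) (N : ℕ) (x : β → ℝ) :
    ((∏ j, kernelF N (x (c j) - x (c (j + 1))) : ℝ) : ℂ) =
      ∏ j, ∑ k ∈ Finset.range N, Complex.exp (Complex.I * k * (x (c j) - x (c (j + 1)) : ℝ)) := by
  have hzero : ∑ j, ((x (c j) - x (c (j + 1)) : ℝ) : ℂ) = 0 := by
    rw [← Complex.ofReal_sum, Finset.sum_sub_distrib, sum_comp_add_one fun j => x (c j), sub_self,
      Complex.ofReal_zero]
  have h1 : ∏ j, Complex.exp (Complex.I / 2 * (x (c j) - x (c (j + 1)) : ℝ)) = 1 := by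
    rw [← Complex.exp_sum, ← Finset.mul_sum, hzero, mul_zero, Complex.exp_zero]
  have h2 : ∏ j, Complex.exp (N * (Complex.I / 2 * (x (c j) - x (c (j + 1)) : ℝ))) = 1 := by
    rw [← Complex.exp_sum, ← Finset.mul_sum, ← Finset.mul_sum, hzero, mul_zero, mul_zero,
      Complex.exp_zero]
  rw [Complex.ofReal_prod, ← one_mul (∏ j, (kernelF N _ : ℂ)), ← h2, ← Finset.prod_mul_distrib,
    ← one_mul (∏ j, ∑ k ∈ Finset.range N, _), ← h1, ← Finset.prod_mul_distrib]
  exact Finset.prod_congr rfl fun j _ => (exp_mul_sum_exp N _).symm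

theorem prod_kernelF_eq_sum {β : Type*} [Fintype β] [DecidableEq β] (c : Fin n → β) (N : ℕ)
    (x : β → ℝ) :
    ((∏ j, kernelF N (x (c j) - x (c (j + 1))) : ℝ) : ℂ) =
      ∑ k ∈ latticeBox n N, ∏ b, Complex.exp (-Complex.I * (cyclicFlux c k b : ℂ) * x b) := by
  rw [prod_kernelF_cyclic]
  have h : ∀ j, ∑ k ∈ Finset.range N,
        Complex.exp (Complex.I * k * (x (c j) - x (c (j + 1)) : ℝ)) =
      ∑ k ∈ (Finset.range N).map Nat.castEmbedding,
        Complex.exp (Complex.I * (k : ℤ) * (x (c j) - x (c (j + 1)) : ℝ)) := by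
    intro j
    rw [Finset.sum_map]
    simp
  simp only [h]
  rw [Finset.prod_univ_sum]
  refine Finset.sum_congr rfl fun k _ => ?_
  rw [← Complex.exp_sum, ← Complex.exp_sum]
  congr 1
  simp only [mul_assoc, ← Finset.mul_sum]
  rw [sum_cyclicFlux_mul c k fun b => (x b : ℂ), neg_mul, ← mul_neg, ← Finset.sum_neg_distrib]
  congr 1
  refine Finset.sum_congr rfl fun j _ => ?_
  push_cast
  ring

theorem norm_exp_neg_I_mul (m : ℤ) (t : ℝ) :
    ‖Complex.exp (-Complex.I * (m : ℂ) * (t : ℂ))‖ = 1 := by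
  rw [show -Complex.I * (m : ℂ) * (t : ℂ) = ((-(m : ℝ) * t : ℝ) : ℂ) * Complex.I by
    push_cast; ring]
  exact Complex.norm_exp_ofReal_mul_I _

theorem integral_prod_kernelF {β : Type*} [Fintype β] [DecidableEq β] (c : Fin n → β) (N : ℕ)
    (ν : Measure ℝ) [IsProbabilityMeasure ν] {φ : ℤ → ℝ}
    (hφ : ∀ m, fourierCoefficient ν m = φ m) :
    ∫ x : β → ℝ, ∏ j, kernelF N (x (c j) - x (c (j + 1))) ∂(Measure.pi fun _ => ν) =
      ∑ k ∈ latticeBox n N, ∏ b, φ (cyclicFlux c k b) := by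
  rw [← Complex.ofReal_inj, ← integral_complex_ofReal]
  simp only [prod_kernelF_eq_sum]
  rw [integral_finsetSum]
  · push_cast
    refine Finset.sum_congr rfl fun k _ => ?_
    rw [integral_fintype_prod_eq_prod
      fun b (t : ℝ) => Complex.exp (-Complex.I * (cyclicFlux c k b : ℂ) * (t : ℂ))]
    exact Finset.prod_congr rfl fun b _ => hφ _
  · intro k _
    refine Integrable.of_bound (Continuous.aestronglyMeasurable (by fun_prop)) 1
      (ae_of_all _ fun x => ?_)
    simp only [norm_prod, norm_exp_neg_I_mul, Finset.prod_const_one, le_refl]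

end Kernel

/-! ### Existence of the coefficients, and the uniform law -/

section ExpansionCoefficient

theorem HasAdmissibleDensity.fourierCoefficient_eq {ν : Measure ℝ} {p : ℝ → ℝ}
    (h : HasAdmissibleDensity ν p) (m : ℤ) :
    fourierCoefficient ν m = phaseIntegral (fun t => (p t : ℂ)) m := by
  have hp : MemLp p 1 lebesgueOnPhases := by exact_mod_cast h.memLp 1 le_rfl
  rw [fourierCoefficient, phaseIntegral, h.eq_withDensity,
    integral_withDensity_eq_integral_toReal_smul₀ hp.1.aemeasurable.ennreal_ofReal
      (ae_of_all _ fun _ => ENNReal.ofReal_lt_top)]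
  refine integral_congr_ae ?_
  filter_upwards [h.density_nonneg] with t ht
  rw [ENNReal.toReal_ofReal ht, Complex.real_smul, mul_comm]

theorem blockOf_surjective {n : ℕ} (ρ : Finpartition (Finset.univ : Finset (Fin n))) :
    Function.Surjective (blockOf ρ) := by
  rintro ⟨s, hs⟩
  obtain ⟨j, hj⟩ := ρ.nonempty_of_mem_parts hs
  exact ⟨j, Subtype.ext (ρ.part_eq_of_mem hs hj)⟩

theorem finiteCoefficient_eq_sum {n : ℕ} [NeZero n]
    (ρ : Finpartition (Finset.univ : Finset (Fin n))) (ν : Measure ℝ) [IsProbabilityMeasure ν]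
    {φ : ℤ → ℝ} (hφ : ∀ m, fourierCoefficient ν m = φ m) (N : ℕ) :
    finiteCoefficient ρ ν N = 1 / (N : ℝ) ^ (n + 1) * (N.descFactorial ρ.parts.card : ℝ) *
      ∑ k ∈ latticeBox n N, φ (-∑ b, reducedFlux (blockOf ρ) k b) *
        ∏ b, φ (reducedFlux (blockOf ρ) k b) := by
  simp only [finiteCoefficient, kernelProduct, integral_prod_kernelF (blockOf ρ) N ν hφ,
    prod_cyclicFlux]

theorem tendsto_descFactorial_div_pow (r : ℕ) :
    Tendsto (fun N : ℕ => (N.descFactorial r : ℝ) / (N : ℝ) ^ r) atTop (𝓝 1) := by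
  refine (Asymptotics.isEquivalent_iff_tendsto_one ?_).1 (isEquivalent_descFactorial r)
  filter_upwards [eventually_gt_atTop 0] with N hN
  positivity

/-- The order of quantifiers is the point: `V` is chosen before `ν`, so it cancels when two laws are
compared. -/
theorem exists_tendsto_finiteCoefficient {n : ℕ} [NeZero n]
    (ρ : Finpartition (Finset.univ : Finset (Fin n))) :
    ∃ V : ℝ, ∀ (ν : Measure ℝ) (p : ℝ → ℝ), HasAdmissibleDensity ν p →
      IsExpansionCoefficient ρ ν (V * ((2 * Real.pi) ^ (ρ.parts.card - 1) *
        ∫ x in (-Real.pi)..Real.pi, p x ^ ρ.parts.card)) := by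
  obtain ⟨d, hd, V, hV⟩ := exists_tendsto_box_average (reducedFlux (blockOf ρ))
    (reducedFlux_surjective (blockOf_surjective ρ)) (reducedFlux_one _)
  refine ⟨V, fun ν p h => ?_⟩
  have := h.isProbabilityMeasure
  let φ : ℤ → ℝ := fun m => (fourierCoefficient ν m).re
  have hφ : ∀ m, fourierCoefficient ν m = φ m := fun m =>
    Complex.ext rfl (h.fourier_nonneg m).2
  have hφ0 : ∀ m, 0 ≤ φ m := fun m => (h.fourier_nonneg m).1
  have hcard : ρ.parts.card = Fintype.card {b // b ≠ blockOf ρ 0} + 1 := by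
    rw [← Fintype.card_coe, ← Finset.card_univ, Finset.card_eq_sum_ones,
      Fintype.sum_eq_add_sum_subtype_ne _ (blockOf ρ 0)]
    simp [add_comm]
  have hsum := hasSum_density_coefficients (κ := {b // b ≠ blockOf ρ 0}) h.memLp hφ0
    fun m => by rw [← h.fourierCoefficient_eq, hφ]
  have hlim := (tendsto_descFactorial_div_pow ρ.parts.card).mul
    (hV _ _ (fun m => mul_nonneg (hφ0 _) (Finset.prod_nonneg fun i _ => hφ0 _)) hsum)
  rw [one_mul] at hlim
  rw [IsExpansionCoefficient, hcard, Nat.add_sub_cancel, ← hcard]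
  rw [← hcard] at hlim
  refine hlim.congr fun N => ?_
  -- Of the powers of `N`, `r` normalize the falling factorial and `d` the lattice sum.
  rw [finiteCoefficient_eq_sum ρ ν hφ, show n + 1 = ρ.parts.card + d by omega, pow_add]
  rw [div_mul_div_comm, one_div, div_eq_inv_mul, mul_assoc]

theorem phaseIntegral_one (m : ℤ) :
    phaseIntegral (fun _ => 1) m = if m = 0 then (2 * Real.pi : ℂ) else 0 := by
  simp only [phaseIntegral, mul_one, integral_lebesgueOnPhases]
  split_ifs with h
  · simp only [h, Int.cast_zero, mul_zero, zero_mul, Complex.exp_zero,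
      intervalIntegral.integral_const, Complex.real_smul]
    push_cast
    ring
  · have hc : -Complex.I * (m : ℂ) ≠ 0 :=
      mul_ne_zero (neg_ne_zero.2 Complex.I_ne_zero) (by exact_mod_cast h)
    rw [integral_exp_mul_complex hc, div_eq_zero_iff, sub_eq_zero]
    left
    rw [Complex.exp_eq_exp_iff_exists_int]
    refine ⟨-m, ?_⟩
    push_cast
    ring

theorem hasAdmissibleDensity_uniformLaw :
    HasAdmissibleDensity uniformLaw fun _ => 1 / (2 * Real.pi) where
  isProbabilityMeasure := by
    constructor
    rw [uniformLaw, Measure.smul_apply, lebesgueOnPhases, Measure.restrict_apply_univ,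
      Real.volume_Icc, smul_eq_mul, ← ENNReal.ofReal_mul (by positivity)]
    rw [show 1 / (2 * Real.pi) * (Real.pi - -Real.pi) = 1 by field_simp; ring, ENNReal.ofReal_one]
  density_nonneg := ae_of_all _ fun _ => by positivity
  eq_withDensity := by rw [uniformLaw, withDensity_const]
  memLp := fun q _ => memLp_const _
  fourier_nonneg := by
    intro m
    have h : fourierCoefficient uniformLaw m = if m = 0 then 1 else 0 := by
      have h1 := phaseIntegral_one m
      simp only [phaseIntegral, mul_one] at h1
      rw [fourierCoefficient, uniformLaw, integral_smul_measure, h1,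
        ENNReal.toReal_ofReal (by positivity), Complex.real_smul]
      have : (Real.pi : ℂ) ≠ 0 := by exact_mod_cast Real.pi_ne_zero
      split_ifs
      · push_cast; field_simp
      · simp
    rw [h]
    split_ifs <;> simp

end ExpansionCoefficient

/-! ### An admissible density that is not essentially bounded -/

section UnboundedDensity

/-- The Fejér kernel of order `M`, normalized to take the value `1` at the origin. -/
def normalizedFejer (M : ℕ) (x : ℝ) : ℝ :=
  ‖(M : ℂ)⁻¹ * ∑ j ∈ Finset.range M, Complex.exp (Complex.I * j * x)‖ ^ 2

theorem continuous_normalizedFejer (M : ℕ) : Continuous (normalizedFejer M) := by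
  unfold normalizedFejer
  fun_prop

theorem normalizedFejer_nonneg (M : ℕ) (x : ℝ) : 0 ≤ normalizedFejer M x := sq_nonneg _

theorem normalizedFejer_zero {M : ℕ} (hM : 0 < M) : normalizedFejer M 0 = 1 := by
  have : (M : ℂ) ≠ 0 := by exact_mod_cast hM.ne'
  simp [normalizedFejer, this]

theorem normalizedFejer_le_one (M : ℕ) (x : ℝ) : normalizedFejer M x ≤ 1 := by
  have h : ‖∑ j ∈ Finset.range M, Complex.exp (Complex.I * j * x)‖ ≤ M := by
    refine (norm_sum_le _ _).trans ?_
    have : ∀ j : ℕ, ‖Complex.exp (Complex.I * j * x)‖ = 1 := by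
      intro j
      rw [show Complex.I * j * x = ((j * x : ℝ) : ℂ) * Complex.I by push_cast; ring]
      exact Complex.norm_exp_ofReal_mul_I _
    simp [this]
  refine pow_le_one₀ (norm_nonneg _) ?_
  rw [norm_mul, norm_inv, Complex.norm_natCast]
  exact inv_mul_le_one_of_le₀ h (Nat.cast_nonneg _)

theorem normalizedFejer_eq_sum (M : ℕ) (x : ℝ) :
    (normalizedFejer M x : ℂ) = ((M : ℂ) ^ 2)⁻¹ *
      ∑ j ∈ Finset.range M, ∑ l ∈ Finset.range M,
        Complex.exp (-Complex.I * (((l : ℤ) - j : ℤ) : ℂ) * x) := by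
  rw [normalizedFejer, Complex.ofReal_pow, ← Complex.mul_conj', map_mul, map_sum, map_inv₀,
    Complex.conj_natCast, mul_mul_mul_comm, Finset.sum_mul_sum, ← mul_inv, ← sq]
  congr 1
  refine Finset.sum_congr rfl fun j _ => Finset.sum_congr rfl fun l _ => ?_
  rw [← Complex.exp_conj, ← Complex.exp_add]
  simp only [map_mul, Complex.conj_I, Complex.conj_natCast, Complex.conj_ofReal]
  congr 1
  push_cast
  ring

theorem phaseIntegral_normalizedFejer (M : ℕ) (m : ℤ) :
    phaseIntegral (fun t => (normalizedFejer M t : ℂ)) m =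
      ((((M : ℝ) ^ 2)⁻¹ * ∑ j ∈ Finset.range M, ∑ l ∈ Finset.range M,
        if m + ((l : ℤ) - j) = 0 then 2 * Real.pi else 0 : ℝ) : ℂ) := by
  have h : ∀ t : ℝ, Complex.exp (-Complex.I * (m : ℂ) * (t : ℂ)) * (normalizedFejer M t : ℂ) =
      ((M : ℂ) ^ 2)⁻¹ * ∑ j ∈ Finset.range M, ∑ l ∈ Finset.range M,
        Complex.exp (-Complex.I * ((m + ((l : ℤ) - j) : ℤ) : ℂ) * t) := by
    intro t
    rw [normalizedFejer_eq_sum, mul_left_comm, Finset.mul_sum]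
    congr 1
    refine Finset.sum_congr rfl fun j _ => ?_
    rw [Finset.mul_sum]
    refine Finset.sum_congr rfl fun l _ => ?_
    rw [← Complex.exp_add]
    congr 1
    push_cast
    ring
  have hint : ∀ r : ℤ, Integrable (fun t : ℝ => Complex.exp (-Complex.I * (r : ℂ) * (t : ℂ)))
      lebesgueOnPhases := fun r =>
    Integrable.of_bound (Continuous.aestronglyMeasurable (by fun_prop)) 1
      (ae_of_all _ fun t => (norm_exp_neg_I_mul r t).le)
  simp only [phaseIntegral, h]
  rw [integral_const_mul, integral_finsetSum _ fun j _ => integrable_finsetSum _ fun l _ => hint _,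
    Complex.ofReal_mul, Complex.ofReal_inv, Complex.ofReal_pow, Complex.ofReal_natCast,
    Complex.ofReal_sum]
  congr 1
  refine Finset.sum_congr rfl fun j _ => ?_
  rw [integral_finsetSum _ fun l _ => hint _, Complex.ofReal_sum]
  refine Finset.sum_congr rfl fun l _ => ?_
  have := phaseIntegral_one (m + ((l : ℤ) - j))
  simp only [phaseIntegral, mul_one] at this
  rw [this]
  split_ifs <;> push_cast <;> rfl

theorem integral_normalizedFejer {M : ℕ} (hM : 0 < M) :
    ∫ t, normalizedFejer M t ∂lebesgueOnPhases = 2 * Real.pi / M := by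
  have h := phaseIntegral_normalizedFejer M 0
  simp only [phaseIntegral, Int.cast_zero, mul_zero, zero_mul, Complex.exp_zero, one_mul,
    integral_complex_ofReal, Complex.ofReal_inj] at h
  rw [h]
  have hM' : (M : ℝ) ≠ 0 := by exact_mod_cast hM.ne'
  have : ∀ j ∈ Finset.range M, (∑ l ∈ Finset.range M,
      if (0 : ℤ) + ((l : ℤ) - j) = 0 then 2 * Real.pi else 0) = 2 * Real.pi := by
    intro j hj
    simp only [zero_add, sub_eq_zero, Nat.cast_inj, Finset.sum_ite_eq', hj, if_true]
  rw [Finset.sum_congr rfl this, Finset.sum_const, Finset.card_range, nsmul_eq_mul]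
  field_simp

theorem memLp_normalizedFejer (M : ℕ) (q : ENNReal) :
    MemLp (normalizedFejer M) q lebesgueOnPhases :=
  MemLp.of_bound (continuous_normalizedFejer M).aestronglyMeasurable 1 (ae_of_all _ fun x => by
    rw [Real.norm_of_nonneg (normalizedFejer_nonneg M x)]
    exact normalizedFejer_le_one M x)

/-- Values lie in `[0,1]`, so the `q`-th power is at most the function itself. For `M = 2^k` the
bounds are geometric in `k`. -/
theorem eLpNorm_normalizedFejer_le {M : ℕ} (hM : 0 < M) {q : NNReal} (hq : 1 ≤ q) :
    eLpNorm (normalizedFejer M) q lebesgueOnPhases ≤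
      ENNReal.ofReal (2 * Real.pi / M) ^ (1 / (q : ℝ)) := by
  have hq' : (1 : ℝ) ≤ q := by exact_mod_cast hq
  rw [eLpNorm_eq_lintegral_rpow_enorm_toReal
    (by exact_mod_cast (zero_lt_one.trans_le hq).ne') ENNReal.coe_ne_top, ENNReal.coe_toReal]
  refine ENNReal.rpow_le_rpow ?_ (by positivity)
  rw [← integral_normalizedFejer hM, ofReal_integral_eq_lintegral_ofReal
    (memLp_one_iff_integrable.1 (memLp_normalizedFejer M 1))
    (ae_of_all _ (normalizedFejer_nonneg M))]
  refine lintegral_mono fun x => ?_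
  rw [Real.enorm_of_nonneg (normalizedFejer_nonneg M x)]
  conv_rhs => rw [← ENNReal.rpow_one (ENNReal.ofReal _)]
  refine ENNReal.rpow_le_rpow_of_exponent_ge ?_ hq'
  exact ENNReal.ofReal_le_one.2 (normalizedFejer_le_one M x)

theorem tsum_eLpNorm_normalizedFejer_ne_top {q : NNReal} (hq : 1 ≤ q) :
    ∑' k : ℕ, eLpNorm (normalizedFejer (2 ^ k)) q lebesgueOnPhases ≠ ⊤ := by
  have hq' : (0 : ℝ) < 1 / q := by
    have : (1 : ℝ) ≤ q := by exact_mod_cast hq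
    positivity
  have hs : Summable fun k : ℕ =>
      (2 * Real.pi) ^ (1 / (q : ℝ)) * ((1 / 2 : ℝ) ^ (1 / (q : ℝ))) ^ k :=
    (summable_geometric_of_lt_one (by positivity)
      (Real.rpow_lt_one (by norm_num) (by norm_num) hq')).mul_left _
  refine ne_top_of_le_ne_top hs.tsum_ofReal_ne_top (ENNReal.tsum_le_tsum fun k => ?_)
  refine (eLpNorm_normalizedFejer_le (pow_pos two_pos k) hq).trans_eq ?_
  rw [ENNReal.ofReal_rpow_of_nonneg (by positivity) hq'.le]
  congr 1
  rw [← Real.rpow_natCast, ← Real.rpow_mul (by norm_num), mul_comm (1 / (q : ℝ)),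
    Real.rpow_mul (by norm_num),
    Real.rpow_natCast, ← Real.mul_rpow (by positivity) (by positivity)]
  push_cast
  rw [one_div_pow, mul_one_div]

theorem memLp_tsum {μ : Measure ℝ} {q : ENNReal} (hq : 1 ≤ q) {f : ℕ → ℝ → ℝ}
    (hf : ∀ k, MemLp (f k) q μ) (hsum : ∑' k, eLpNorm (f k) q μ ≠ ⊤) :
    MemLp (fun x => ∑' k, f k x) q μ := by
  have : Fact (1 ≤ q) := ⟨hq⟩
  have h := Lp.coeFn_tsum (f := fun k => (hf k).toLp (f k))
    (by simpa only [Lp.enorm_toLp] using hsum)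
  refine (Lp.memLp (∑' k, (hf k).toLp (f k))).ae_eq (h.trans ?_)
  filter_upwards [ae_all_iff.2 fun k => (hf k).coeFn_toLp] with x hx
  simp only [hx]

/-- A nonnegative function on `[-π, π]` that lies in every `L^q`, `q < ∞`, but not in `L^∞`. -/
def fejerSum (x : ℝ) : ℝ := ∑' k : ℕ, normalizedFejer (2 ^ k) x

theorem fejerSum_nonneg (x : ℝ) : 0 ≤ fejerSum x :=
  tsum_nonneg fun _ => normalizedFejer_nonneg _ x

theorem memLp_fejerSum {q : NNReal} (hq : 1 ≤ q) : MemLp fejerSum q lebesgueOnPhases :=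
  memLp_tsum (by exact_mod_cast hq) (fun k => memLp_normalizedFejer (2 ^ k) q)
    (tsum_eLpNorm_normalizedFejer_ne_top hq)

theorem ae_summable_normalizedFejer :
    ∀ᵐ x ∂lebesgueOnPhases, Summable fun k : ℕ => normalizedFejer (2 ^ k) x := by
  have h := summable_norm_of_tsum_eLpNorm_ne_top (p := (1 : NNReal)) (by norm_num)
    (fun k => (memLp_normalizedFejer (2 ^ k) (1 : NNReal)).1)
    (tsum_eLpNorm_normalizedFejer_ne_top le_rfl)
  filter_upwards [h] with x hx using hx.of_norm

theorem hasSum_phaseIntegral_fejerSum (m : ℤ) :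
    HasSum (fun k : ℕ => phaseIntegral (fun t => (normalizedFejer (2 ^ k) t : ℂ)) m)
      (phaseIntegral (fun t => (fejerSum t : ℂ)) m) := by
  have hnorm : ∀ (k : ℕ) (t : ℝ), ‖Complex.exp (-Complex.I * (m : ℂ) * (t : ℂ)) *
      (normalizedFejer (2 ^ k) t : ℂ)‖ = normalizedFejer (2 ^ k) t := by
    intro k t
    rw [norm_mul, norm_exp_neg_I_mul, one_mul, Complex.norm_real,
      Real.norm_of_nonneg (normalizedFejer_nonneg _ t)]
  have h := hasSum_integral_of_summable_integral_norm (μ := lebesgueOnPhases)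
    (F := fun (k : ℕ) (t : ℝ) => Complex.exp (-Complex.I * (m : ℂ) * (t : ℂ)) *
      (normalizedFejer (2 ^ k) t : ℂ)) ?_ ?_
  · convert! h using 1
    refine integral_congr_ae (ae_of_all _ fun t => ?_)
    simp only [fejerSum, Complex.ofReal_tsum, tsum_mul_left]
  · intro k
    refine Integrable.of_bound (Continuous.aestronglyMeasurable ?_) 1 (ae_of_all _ fun t => ?_)
    · have := continuous_normalizedFejer (2 ^ k)
      fun_prop
    · rw [hnorm]
      exact normalizedFejer_le_one _ t
  · simp only [hnorm, integral_normalizedFejer (pow_pos two_pos _)]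
    push_cast
    simpa only [div_eq_mul_inv, ← inv_pow] using
      (summable_geometric_of_lt_one (by norm_num) (by norm_num : (2⁻¹ : ℝ) < 1)).mul_left
        (2 * Real.pi)

theorem integral_fejerSum : ∫ t, fejerSum t ∂lebesgueOnPhases = 4 * Real.pi := by
  have h := Complex.reCLM.hasSum (hasSum_phaseIntegral_fejerSum 0)
  simp only [phaseIntegral, Int.cast_zero, mul_zero, zero_mul, Complex.exp_zero, one_mul,
    integral_complex_ofReal, Complex.reCLM_apply, Complex.ofReal_re,
    integral_normalizedFejer (pow_pos two_pos _)] at h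
  refine h.unique ?_
  push_cast
  convert! hasSum_geometric_two.mul_left (2 * Real.pi) using 1
  · ext k
    rw [one_div_pow, mul_one_div]
  · ring

theorem not_memLp_top_fejerSum : ¬ MemLp fejerSum ⊤ lebesgueOnPhases := by
  intro h
  obtain ⟨C, hC⟩ : ∃ C : ℝ, ∀ᵐ x ∂lebesgueOnPhases, fejerSum x ≤ C := by
    refine ⟨lpNorm fejerSum ⊤ lebesgueOnPhases, ?_⟩
    filter_upwards [ae_le_lpNorm_exponent_top h] with x hx
    exact (le_abs_self _).trans hx
  -- The first `K` kernels sum to a continuous function with value `K > C` at `0`, so `C` is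
  -- exceeded on a nonempty open set.
  obtain ⟨K, hK⟩ := exists_nat_gt C
  let S : ℝ → ℝ := fun x => ∑ k ∈ Finset.range K, normalizedFejer (2 ^ k) x
  have hS : Continuous S := continuous_finsetSum _ fun k _ => continuous_normalizedFejer _
  have hS0 : S 0 = K := by
    simp only [S, normalizedFejer_zero (pow_pos two_pos _), Finset.sum_const, Finset.card_range,
      nsmul_eq_mul, mul_one]
  have hle : ∀ᵐ x ∂lebesgueOnPhases, S x ≤ C := by
    filter_upwards [hC, ae_summable_normalizedFejer] with x hx hs
    exact (hs.sum_le_tsum _ fun k _ => normalizedFejer_nonneg _ x).trans hx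
  let U : Set ℝ := {x | C < S x} ∩ Set.Ioo (-Real.pi) Real.pi
  have hU : IsOpen U := (isOpen_lt continuous_const hS).inter isOpen_Ioo
  have hUne : U.Nonempty := ⟨0, by simpa only [Set.mem_ofPred_eq, hS0] using hK,
    neg_lt_zero.2 Real.pi_pos, Real.pi_pos⟩
  refine (hU.measure_pos volume hUne).ne' ?_
  have h0 : lebesgueOnPhases U = 0 :=
    measure_mono_null (fun x hx => not_le.2 hx.1) (ae_iff.1 hle)
  rwa [lebesgueOnPhases, Measure.restrict_apply hU.measurableSet, Set.inter_eq_left.2] at h0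
  exact fun x hx => Set.Ioo_subset_Icc_self hx.2

theorem exists_unbounded_admissible_density :
    ∃ (ν : Measure ℝ) (p : ℝ → ℝ), HasAdmissibleDensity ν p ∧ ¬ MemLp p ⊤ lebesgueOnPhases := by
  have hpi : 0 < 4 * Real.pi := by positivity
  have hnonneg : ∀ x, 0 ≤ (4 * Real.pi)⁻¹ * fejerSum x := fun x =>
    mul_nonneg (inv_nonneg.2 hpi.le) (fejerSum_nonneg x)
  have hmem : ∀ q : NNReal, 1 ≤ q →
      MemLp (fun x => (4 * Real.pi)⁻¹ * fejerSum x) (q : ENNReal) lebesgueOnPhases :=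
    fun q hq => (memLp_fejerSum hq).const_mul _
  have hint : Integrable (fun x => (4 * Real.pi)⁻¹ * fejerSum x) lebesgueOnPhases :=
    memLp_one_iff_integrable.1 (by exact_mod_cast hmem 1 le_rfl)
  refine ⟨lebesgueOnPhases.withDensity fun x => ENNReal.ofReal ((4 * Real.pi)⁻¹ * fejerSum x),
    fun x => (4 * Real.pi)⁻¹ * fejerSum x, ⟨⟨?_⟩, ae_of_all _ hnonneg, rfl, hmem, fun m => ?_⟩,
    fun h => not_memLp_top_fejerSum ?_⟩
  · rw [withDensity_apply _ MeasurableSet.univ, Measure.restrict_univ,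
      ← ofReal_integral_eq_lintegral_ofReal hint (ae_of_all _ hnonneg), integral_const_mul,
      integral_fejerSum, inv_mul_cancel₀ hpi.ne', ENNReal.ofReal_one]
  · have hcoef : fourierCoefficient (lebesgueOnPhases.withDensity fun x =>
        ENNReal.ofReal ((4 * Real.pi)⁻¹ * fejerSum x)) m =
        (((4 * Real.pi)⁻¹ : ℝ) : ℂ) * phaseIntegral (fun t => (fejerSum t : ℂ)) m := by
      rw [fourierCoefficient, phaseIntegral, ← integral_const_mul,
        integral_withDensity_eq_integral_toReal_smul₀ hint.1.aemeasurable.ennreal_ofReal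
          (ae_of_all _ fun _ => ENNReal.ofReal_lt_top)]
      congr 1
      ext t
      rw [ENNReal.toReal_ofReal (hnonneg t), Complex.real_smul]
      push_cast
      ring
    have hsum := hasSum_phaseIntegral_fejerSum m
    simp only [phaseIntegral_normalizedFejer] at hsum
    have hre := Complex.reCLM.hasSum hsum
    have him := Complex.imCLM.hasSum hsum
    simp only [Complex.reCLM_apply, Complex.ofReal_re] at hre
    simp only [Complex.imCLM_apply, Complex.ofReal_im] at him
    rw [hcoef, Complex.re_ofReal_mul, Complex.im_ofReal_mul]
    refine ⟨mul_nonneg (inv_nonneg.2 hpi.le) (hre.nonneg fun k => ?_), ?_⟩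
    · refine mul_nonneg (by positivity)
        (Finset.sum_nonneg fun j _ => Finset.sum_nonneg fun l _ => ?_)
      split_ifs <;> positivity
    · rw [him.unique hasSum_zero, mul_zero]
  · have := h.const_mul (4 * Real.pi)
    simpa only [mul_inv_cancel_left₀ hpi.ne'] using this

end UnboundedDensity

end

end RandomVandermonde

theorem mainTheorem1 :
    (∀ (ν : MeasureTheory.Measure ℝ) (p : ℝ → ℝ), RandomVandermonde.HasAdmissibleDensity ν p →
      ∀ (n : ℕ) [NeZero n] (ρ : Finpartition (Finset.univ : Finset (Fin n))),
        ∃ Kν Ku : ℝ,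
          RandomVandermonde.IsExpansionCoefficient ρ ν Kν ∧
          RandomVandermonde.IsExpansionCoefficient ρ RandomVandermonde.uniformLaw Ku ∧
          Kν = Ku * (2 * Real.pi) ^ (ρ.parts.card - 1) *
            ∫ x in (-Real.pi)..Real.pi, p x ^ ρ.parts.card) ∧
    (∃ (ν : MeasureTheory.Measure ℝ) (p : ℝ → ℝ), RandomVandermonde.HasAdmissibleDensity ν p ∧
      ¬ MeasureTheory.MemLp p ⊤ RandomVandermonde.lebesgueOnPhases) := by
  refine ⟨fun ν p h n _ ρ => ?_, RandomVandermonde.exists_unbounded_admissible_density⟩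
  obtain ⟨V, hV⟩ := RandomVandermonde.exists_tendsto_finiteCoefficient ρ
  refine ⟨_, _, hV ν p h, hV _ _ RandomVandermonde.hasAdmissibleDensity_uniformLaw, ?_⟩
  have hr : ρ.parts.card = ρ.parts.card - 1 + 1 :=
    (Nat.succ_pred_eq_of_pos (Finset.card_pos.2 ⟨_, (RandomVandermonde.blockOf ρ 0).2⟩)).symm
  -- For the uniform density the moment factor is `1`, which identifies `V` with `Ku`.
  have hu : (2 * Real.pi) ^ (ρ.parts.card - 1) *
      ∫ _x in (-Real.pi)..Real.pi, (1 / (2 * Real.pi)) ^ ρ.parts.card = 1 := by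
    rw [intervalIntegral.integral_const, smul_eq_mul, hr, Nat.add_sub_cancel, pow_succ, one_div,
      inv_pow]
    field_simp
    ring
  rw [hu, mul_one, mul_assoc]
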